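/- Consider one uncooperative user and one adaptive user sharing a collision channel in slots $t=0,1,2,\dots$. Let $\lambda\in(0,1)$, and let the packet arrivals $A(t)\in\{0,1\}$ to the uncooperative user be i.i.d. Bernoulli($\lambda$). Its queue is empty before slot $0$; let $Q(t)$ be the number of packets in its queue just after the arrival $A(t)$. In each slot $t$ with $Q(t)>0$ the uncooperative user transmits one packet. That packet leaves the queue at the end of the slot if the adaptive user does not transmit in slot $t$; if the adaptive user does transmit in slot $t$, a collision occurs and the packet stays in the queue. The adaptive user (which always has a packet, possibly a dummy packet, to send) follows the policy $\pi^{lb}$ with parameter $p\in[0,1]$: in slot $t$ it does not transmit if a collision occurred in slot $t-1$, and otherwise it transmits with probability $p$, by randomization that is independent across slots and independent of the arrivals; no collision precedes slot $0$. Let $$p^*=\begin{cases}1,&\lambda\le\tfrac13,\\[2pt]\dfrac{1-\lambda}{2\lambda},&\lambda>\tfrac13.\end{cases}$$ Then, under $\pi^{lb}$ with $p=p^*$, the expectation $E[Q(T)]$ is finite for every $T$, and it converges to a finite limit as $T\to\infty$: $$\lim_{T\to\infty}E[Q(T)]<\infty .$$ -/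

import Mathlib

open MeasureTheory ProbabilityTheory Filter Topology
open scoped unitInterval

namespace SpectrumSharing

/-- Actions of the adaptive user: transmit or do not transmit. -/
inductive Action where
  | TR
  | NT
  deriving DecidableEq

/-- Ternary channel feedback: success, collision, idle. -/
inductive Feedback where
  | S
  | C
  | I
  deriving DecidableEq

/-- The feedback of a slot in which the uncooperative user has `q` packets in queue (it transmits
iff `0 < q`) and the adaptive user takes action `u`. -/
def feedback (q : ℕ) (u : Action) : Feedback :=
  match u with
  | .TR => if q = 0 then .S else .C
  | .NT => if q = 0 then .I else .S

/-- The number of packets that leave the uncooperative user's queue in a slot: its head-of-line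
packet departs iff the uncooperative user transmits and the adaptive user does not. -/
def departures (q : ℕ) (u : Action) : ℕ :=
  if 0 < q ∧ u = .NT then 1 else 0

/-- The policy `π^lb`: no transmission if the previous slot's feedback was a collision; otherwise
transmit iff the current coin flip is heads. The previous feedback is `none` in slot `0`. -/
def lbAction (prev : Option Feedback) (coin : Bool) : Action :=
  if prev = some .C then .NT else if coin then .TR else .NT

/-- The pair `(Q(t), u(t))` under `π^lb`, along an arrival sequence `a` and a sequence `c` of coin
flips, starting from an empty queue before the arrival of slot `0`. Here `Q(t)` counts the
packets in queue after the arrival of slot `t` and before the departure of slot `t`. -/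
def run (a : ℕ → ℕ) (c : ℕ → Bool) : ℕ → ℕ × Action
  | 0 => (a 0, lbAction none (c 0))
  | t + 1 =>
    let q := (run a c t).1
    let u := (run a c t).2
    (q - departures q u + a (t + 1), lbAction (some (feedback q u)) (c (t + 1)))

/-- The queue backlog `Q(t)` of the uncooperative user under `π^lb`. -/
def backlog (a : ℕ → ℕ) (c : ℕ → Bool) (t : ℕ) : ℕ := (run a c t).1

/-- The transmission probability `p*`, as a function of the arrival rate `lam`. -/
noncomputable def pStar (lam : I) : I :=
  ⟨if (lam : ℝ) ≤ 1 / 3 then 1 else (1 - lam) / (2 * lam), by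
    have h1 := lam.2.2
    split_ifs with h
    · simp
    · push Not at h
      constructor
      · apply div_nonneg <;> linarith
      · rw [div_le_one (by linarith)]; linarith⟩

end SpectrumSharing

/-! Queue length and collision flag are coded in one integer `w`, ordered so that a freshly collided
queue of `q` sits between uncollided queues of `q - 1` and `q`. The service map is then monotone
(`serve_mono`), so the workload is a stochastically monotone Markov chain started at its minimum
`0`, and the expectation of every monotone function of it is nondecreasing in time.

It remains to bound the mean queue. The corrected queue length `V = potential p` has drift `l - 1 /
(1 + p)` at every nonempty state, which is negative at `p*`. Hence `E[V²]` changes in one step by at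
most `-2 * (1 / (1 + p) - l) * E[V] + 4`. This change is nonnegative by monotonicity, so `E[V] ≤ 2 /
(1 / (1 + p) - l)`. The queue exceeds `V` by at most `1 / 2`, so its mean is nondecreasing and
bounded. -/

namespace SpectrumSharing

/-! ### Coding queue and collision state by one integer -/

/-- The workload left after a slot, before the next arrival: `w = 2 * q` stands for `q` queued packets with no collision
in the previous slot, and `w = 2 * q - 1` for `q` queued packets right after a collision. -/
def serve (w : ℕ) (heads : Bool) : ℕ :=
  if heads then w - 1 else 2 * ((w + 1) / 2) - 2

/-- The workload along an arrival sequence `a` and a coin sequence `c`. -/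
def workload (a : ℕ → ℕ) (c : ℕ → Bool) : ℕ → ℕ
  | 0 => 2 * a 0
  | t + 1 => serve (workload a c t) (c t) + 2 * a (t + 1)

theorem serve_mono (c : Bool) : Monotone (fun w => serve w c) := by
  intro v w h
  cases c <;> simp only [serve] <;> simp <;> omega

/-- Arrivals add even amounts, so the parity of the workload records exactly whether the previous
slot had a collision. Truncated subtraction keeps an empty queue at `0`. -/
theorem run_eq_workload (a : ℕ → ℕ) (c : ℕ → Bool) (t : ℕ) :
    run a c t = ((workload a c t + 1) / 2,
      if workload a c t % 2 = 1 then .NT else if c t then .TR else .NT) := by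
  induction t with
  | zero =>
    simp only [run, workload, lbAction]
    refine Prod.ext ?_ ?_
    · simp only; omega
    · simp
  | succ t ih =>
    rw [run, ih]
    generalize hw : workload a c t = w
    have hw' : workload a c (t + 1) = serve w (c t) + 2 * a (t + 1) := by rw [workload, hw]
    rw [hw']
    rcases Nat.even_or_odd' w with ⟨k, rfl | rfl⟩
    · rcases Nat.eq_zero_or_pos k with rfl | hk
      · cases c t <;> simp [serve, departures, feedback, lbAction] <;> omega
      · have h1 : (2 * k + 1) / 2 = k := by omega
        have h2 : (2 * k - 2 + 2 * a (t + 1)) % 2 = 0 := by omega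
        have h3 : ((2 * k - 1) + 2 * (a (t + 1))) % 2 = 1 := by omega
        cases c t <;>
          simp [serve, departures, feedback, lbAction, h1, h2, h3, hk, hk.ne'] <;> omega
    · have h1 : (2 * k + 1 + 1) / 2 = k + 1 := by omega
      cases c t <;> simp [serve, departures, feedback, lbAction, h1] <;> omega

theorem backlog_eq_workload (a : ℕ → ℕ) (c : ℕ → Bool) (t : ℕ) :
    backlog a c t = (workload a c t + 1) / 2 := by
  rw [backlog, run_eq_workload]

theorem workload_congr {a a' : ℕ → ℕ} {c c' : ℕ → Bool} {t : ℕ}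
    (ha : ∀ i < t + 1, a i = a' i) (hc : ∀ i < t, c i = c' i) :
    workload a c t = workload a' c' t := by
  induction t with
  | zero => simp [workload, ha 0]
  | succ t ih =>
    rw [workload, workload, ih (fun i hi => ha i (by omega)) (fun i hi => hc i (by omega)),
      ha (t + 1) (by omega), hc t (by omega)]

theorem measurable_workload (t : ℕ) :
    Measurable (fun x : (ℕ → ℕ) × (ℕ → Bool) => workload x.1 x.2 t) := by
  induction t with
  | zero => simp only [workload]; fun_prop
  | succ t ih =>
    simp only [workload]
    have h : Measurable (fun z : ℕ × Bool => serve z.1 z.2) := measurable_of_countable _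
    have h2 : Measurable (fun x : (ℕ → ℕ) × (ℕ → Bool) => (workload x.1 x.2 t, x.2 t)) := by
      fun_prop
    exact (h.comp h2).add (by fun_prop)

/-! ### Monotonicity of the transition operator -/

/-- The one-step transition operator of the workload. -/
noncomputable def transition (l p : ℝ) (g : ℕ → ℝ) (w : ℕ) : ℝ :=
  l * (p * g (serve w true + 2) + (1 - p) * g (serve w false + 2)) +
    (1 - l) * (p * g (serve w true) + (1 - p) * g (serve w false))

section Transition

variable {l p : ℝ}

theorem transition_le (hl : l ∈ Set.Icc (0 : ℝ) 1) (hp : p ∈ Set.Icc (0 : ℝ) 1) {f g : ℕ → ℝ}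
    (h : f ≤ g) : transition l p f ≤ transition l p g := by
  intro w
  have hl' : 0 ≤ 1 - l := sub_nonneg.2 hl.2
  have hp' : 0 ≤ 1 - p := sub_nonneg.2 hp.2
  have hl0 := hl.1
  have hp0 := hp.1
  unfold transition
  gcongr <;> apply h

theorem transition_mono (hl : l ∈ Set.Icc (0 : ℝ) 1) (hp : p ∈ Set.Icc (0 : ℝ) 1) {g : ℕ → ℝ}
    (hg : Monotone g) : Monotone (transition l p g) := by
  intro v w h
  have hl' : 0 ≤ 1 - l := sub_nonneg.2 hl.2
  have hp' : 0 ≤ 1 - p := sub_nonneg.2 hp.2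
  have hl0 := hl.1
  have hp0 := hp.1
  have h1 := serve_mono true h
  have h2 := serve_mono false h
  simp only at h1 h2
  unfold transition
  gcongr <;> apply hg <;> omega

theorem transition_iterate_mono (hl : l ∈ Set.Icc (0 : ℝ) 1) (hp : p ∈ Set.Icc (0 : ℝ) 1)
    {g : ℕ → ℝ} (hg : Monotone g) (n : ℕ) : Monotone ((transition l p)^[n] g) := by
  induction n with
  | zero => exact hg
  | succ n ih => rw [Function.iterate_succ_apply']; exact transition_mono hl hp ih

theorem transition_iterate_le (hl : l ∈ Set.Icc (0 : ℝ) 1) (hp : p ∈ Set.Icc (0 : ℝ) 1)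
    {f g : ℕ → ℝ} (h : f ≤ g) (n : ℕ) : (transition l p)^[n] f ≤ (transition l p)^[n] g := by
  induction n with
  | zero => exact h
  | succ n ih => simp only [Function.iterate_succ_apply']; exact transition_le hl hp ih

theorem le_transition_zero (hl : l ∈ Set.Icc (0 : ℝ) 1) {g : ℕ → ℝ}
    (hg : Monotone g) : g 0 ≤ transition l p g 0 := by
  have h : g 0 ≤ g 2 := hg (by omega)
  have h2 := mul_nonneg hl.1 (sub_nonneg.2 h)
  simp only [transition, serve]
  norm_num
  linarith

/-- Each iterate of `g` is monotone, and from the minimal state `0` a step can only go up. -/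
theorem transition_iterate_zero_mono (hl : l ∈ Set.Icc (0 : ℝ) 1) (hp : p ∈ Set.Icc (0 : ℝ) 1)
    {g : ℕ → ℝ} (hg : Monotone g) : Monotone (fun n => (transition l p)^[n] g 0) := by
  refine monotone_nat_of_le_succ fun n => ?_
  rw [Function.iterate_succ_apply']
  exact le_transition_zero hl (transition_iterate_mono hl hp hg n)

theorem transition_iterate_affine (f g : ℕ → ℝ) (a b : ℝ) (n : ℕ) :
    (transition l p)^[n] (fun w => f w + a * g w + b) =
      fun w => (transition l p)^[n] f w + a * (transition l p)^[n] g w + b := by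
  induction n with
  | zero => rfl
  | succ n ih =>
    simp only [Function.iterate_succ_apply', ih]
    funext w
    simp only [transition]
    ring

/-! ### Quadratic drift bound -/

/-- A potential whose expected one-step increment does not depend on whether a
collision just occurred, as long as the queue is nonempty. -/
noncomputable def potential (p : ℝ) (w : ℕ) : ℝ :=
  ((w + 1) / 2 : ℕ) - p / (1 + p) * (w % 2 : ℕ)

theorem potential_even (p : ℝ) (k : ℕ) : potential p (2 * k) = k := by
  have h : (2 * k + 1) / 2 = k := by omega
  simp [potential, h]

theorem potential_odd (p : ℝ) (k : ℕ) : potential p (2 * k + 1) = k + 1 - p / (1 + p) := by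
  have h : (2 * k + 1 + 1) / 2 = k + 1 := by omega
  have h2 : (2 * k + 1) % 2 = 1 := by omega
  simp [potential, h, h2]

theorem div_one_add_mem (hp : p ∈ Set.Icc (0 : ℝ) 1) : p / (1 + p) ∈ Set.Icc (0 : ℝ) (1 / 2) := by
  obtain ⟨h0, h1⟩ := hp
  refine ⟨by positivity, ?_⟩
  rw [div_le_div_iff₀ (by linarith) (by norm_num)]
  linarith

theorem potential_mono (hp : p ∈ Set.Icc (0 : ℝ) 1) : Monotone (potential p) := by
  obtain ⟨h0, h1⟩ := div_one_add_mem hp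
  refine monotone_nat_of_le_succ fun w => ?_
  rcases Nat.even_or_odd' w with ⟨k, rfl | rfl⟩
  · rw [potential_even, potential_odd]; linarith
  · rw [show 2 * k + 1 + 1 = 2 * (k + 1) by ring, potential_even, potential_odd]
    push_cast; linarith

theorem potential_nonneg (hp : p ∈ Set.Icc (0 : ℝ) 1) (w : ℕ) : 0 ≤ potential p w := by
  have h := potential_mono hp (Nat.zero_le w)
  have h2 := potential_even p 0
  simp at h2
  linarith

theorem queue_le_potential (hp : p ∈ Set.Icc (0 : ℝ) 1) (w : ℕ) :
    (((w + 1) / 2 : ℕ) : ℝ) ≤ potential p w + 1 / 2 := by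
  obtain ⟨h0, h1⟩ := div_one_add_mem hp
  rcases Nat.mod_two_eq_zero_or_one w with h | h <;> simp only [potential, h] <;> push_cast <;>
    linarith

theorem transition_potential_sq_le (hl : l ∈ Set.Icc (0 : ℝ) 1) (hp : p ∈ Set.Icc (0 : ℝ) 1)
    (w : ℕ) :
    transition l p (fun w => potential p w ^ 2) w ≤
      potential p w ^ 2 + -(2 * (1 / (1 + p) - l)) * potential p w + 4 := by
  have hd := div_one_add_mem hp
  have hpd : p / (1 + p) * (1 + p) = p := div_mul_cancel₀ _ (by linarith [hp.1])
  have he : 1 / (1 + p) = 1 - p / (1 + p) := by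
    have : 1 + p ≠ 0 := by linarith [hp.1]
    field_simp; ring
  have heven := potential_even p
  have hodd := potential_odd p
  rw [he]
  generalize p / (1 + p) = d at *
  obtain ⟨hl0, hl1⟩ := hl
  obtain ⟨hp0, hp1⟩ := hp
  obtain ⟨hd0, hd1⟩ := hd
  rcases Nat.even_or_odd' w with ⟨k, rfl | rfl⟩
  · rcases k with _ | k
    · have h0 := heven 0
      have h1 := heven 1
      simp only [mul_zero, mul_one] at h0 h1
      simp [transition, serve, h0, h1]
      linarith
    · have e1 : serve (2 * (k + 1)) true = 2 * k + 1 := by simp [serve]; omega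
      have e2 : serve (2 * (k + 1)) false = 2 * k := by simp [serve]; omega
      simp only [transition, e1, e2, show 2 * k + 1 + 2 = 2 * (k + 1) + 1 by ring,
        show 2 * k + 2 = 2 * (k + 1) by ring, heven, hodd]
      push_cast
      generalize (k : ℝ) = x at *
      have key : l * (p * (x + 1 + 1 - d) ^ 2 + (1 - p) * (x + 1) ^ 2) +
          (1 - l) * (p * (x + 1 - d) ^ 2 + (1 - p) * x ^ 2) =
          (x + 1) ^ 2 + 2 * (x + 1) * (l - (1 - p) - p * d) +
          (l * (p * (1 - d) ^ 2) + (1 - l) * (p * d ^ 2 + (1 - p))) := by ring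
      -- The correction `d = p / (1 + p)` solves `p - p * d = d`, which makes the drift here equal
      -- to the one at odd states.
      have hpd' : l - (1 - p) - p * d = l - (1 - d) := by linarith
      rw [key, hpd']
      have b1 : l * (p * (1 - d) ^ 2) ≤ 1 * (1 * 1 ^ 2) := by gcongr <;> linarith
      have b2 : (1 - l) * (p * d ^ 2 + (1 - p)) ≤ 1 * (1 * 1 ^ 2 + 1) := by
        have : 0 ≤ 1 - p := by linarith
        gcongr <;> linarith
      linarith
  · have e1 : serve (2 * k + 1) true = 2 * k := by simp [serve]
    have e2 : serve (2 * k + 1) false = 2 * k := by simp [serve]; omega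
    simp only [transition, e1, e2, show 2 * k + 2 = 2 * (k + 1) by ring, heven, hodd]
    push_cast
    generalize (k : ℝ) = x at *
    have key : l * (p * (x + 1) ^ 2 + (1 - p) * (x + 1) ^ 2) +
        (1 - l) * (p * x ^ 2 + (1 - p) * x ^ 2) =
        (x + 1 - d) ^ 2 + 2 * (x + 1 - d) * (l - (1 - d)) +
          (l * d ^ 2 + (1 - l) * (1 - d) ^ 2) := by ring
    rw [key]
    have b1 : l * d ^ 2 ≤ 1 * 1 ^ 2 := by gcongr; linarith
    have b2 : (1 - l) * (1 - d) ^ 2 ≤ 1 * 1 ^ 2 := by gcongr <;> linarith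
    linarith

theorem transition_iterate_potential_le (hl : l ∈ Set.Icc (0 : ℝ) 1) (hp : p ∈ Set.Icc (0 : ℝ) 1)
    (hlp : l < 1 / (1 + p)) (n : ℕ) :
    (transition l p)^[n] (potential p) 0 ≤ 2 / (1 / (1 + p) - l) := by
  have hmono : Monotone (fun w => potential p w ^ 2) := fun v w h =>
    pow_le_pow_left₀ (potential_nonneg hp v) (potential_mono hp h) 2
  -- The second moment does not decrease, so the drift inequality forces the bound on the first
  -- moment; no bound on the second moment is needed.
  have h1 := transition_iterate_zero_mono hl hp hmono (Nat.le_succ n)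
  have h2 := transition_iterate_le hl hp
    (fun w => transition_potential_sq_le hl hp w :
      transition l p (fun w => potential p w ^ 2) ≤ fun w =>
        potential p w ^ 2 + -(2 * (1 / (1 + p) - l)) * potential p w + 4) n 0
  rw [transition_iterate_affine (fun w => potential p w ^ 2) (potential p)] at h2
  simp only [Nat.succ_eq_add_one, Function.iterate_succ_apply] at h1
  rw [le_div_iff₀ (by linarith)]
  linarith

theorem transition_iterate_queue_tendsto (hl : l ∈ Set.Icc (0 : ℝ) 1)
    (hp : p ∈ Set.Icc (0 : ℝ) 1) (hlp : l < 1 / (1 + p)) :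
    ∃ L : ℝ, Tendsto (fun n => (transition l p)^[n] (fun w => (((w + 1) / 2 : ℕ) : ℝ)) 0)
      atTop (𝓝 L) := by
  have hmono : Monotone (fun w : ℕ => (((w + 1) / 2 : ℕ) : ℝ)) := fun v w h =>
    Nat.cast_le.2 (Nat.div_le_div_right (by omega))
  refine ⟨_, tendsto_atTop_ciSup (transition_iterate_zero_mono hl hp hmono)
    ⟨2 / (1 / (1 + p) - l) + 1 / 2, ?_⟩⟩
  rintro _ ⟨n, rfl⟩
  have h := transition_iterate_le hl hp
    (fun w => by simpa using queue_le_potential hp w :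
      (fun w : ℕ => (((w + 1) / 2 : ℕ) : ℝ)) ≤ fun w => potential p w + 0 * potential p w + 1 / 2)
    n 0
  rw [transition_iterate_affine] at h
  have h2 := transition_iterate_potential_le hl hp hlp n
  simp only at h ⊢
  linarith

end Transition

/-- For `lam ≤ 1/3` the right side is `1/2`; otherwise it is `2 * lam / (1 + lam)`, which exceeds
`lam` because `lam < 1`. -/
theorem lt_one_div_one_add_pStar (lam : I) (hlam0 : 0 < lam) (hlam1 : lam < 1) :
    (lam : ℝ) < 1 / (1 + (pStar lam : ℝ)) := by
  have h0 : (0 : ℝ) < lam := hlam0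
  have h1 : (lam : ℝ) < 1 := hlam1
  simp only [pStar]
  split_ifs with h
  · linarith
  · rw [lt_div_iff₀ (by have := div_nonneg (sub_nonneg.2 h1.le) (by linarith : (0:ℝ) ≤ 2 * lam)
                        linarith)]
    have : (lam : ℝ) * (1 + (1 - lam) / (2 * lam)) = (1 + lam) / 2 := by field_simp; ring
    linarith

/-! ### From random variables to the transition operator -/

section Probability

variable {Ω : Type*} [MeasurableSpace Ω] {P : Measure Ω} [IsProbabilityMeasure P]

/-- If `X` is independent of `Y` and the pair `(X, Y)` is independent of `Z`, then `X` is
independent of the pair `(Y, Z)`. -/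
theorem indepFun_prodMk_right_of_prodMk_left {α β γ : Type*} [MeasurableSpace α]
    [MeasurableSpace β] [MeasurableSpace γ] {X : Ω → α} {Y : Ω → β} {Z : Ω → γ}
    (hX : AEMeasurable X P) (hY : AEMeasurable Y P) (hZ : AEMeasurable Z P)
    (hXY : IndepFun X Y P) (hXYZ : IndepFun (fun ω => (X ω, Y ω)) Z P) :
    IndepFun X (fun ω => (Y ω, Z ω)) P := by
  have hYZ : IndepFun Y Z P := hXYZ.comp measurable_snd measurable_id
  have := Measure.isProbabilityMeasure_map hX
  have := Measure.isProbabilityMeasure_map hY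
  have := Measure.isProbabilityMeasure_map hZ
  rw [indepFun_iff_map_prod_eq_prod_map_map hX (hY.prodMk hZ), hYZ.map_prod_eq_prod_map_map hY hZ,
    ← Measure.prodAssoc_prod, ← hXY.map_prod_eq_prod_map_map hX hY,
    ← hXYZ.map_prod_eq_prod_map_map (hX.prodMk hY) hZ,
    AEMeasurable.map_map_of_aemeasurable (MeasurableEquiv.measurable _).aemeasurable
      ((hX.prodMk hY).prodMk hZ)]
  rfl

/-- Integration against an independent Bernoulli variable. -/
theorem integral_bernoulli_of_indepFun {α β : Type*} [MeasurableSpace α] [MeasurableSpace β]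
    {X : Ω → α} {Y : Ω → β} {x y : β} {p : I} (hX : AEMeasurable X P)
    (hY : HasLaw Y (bernoulliMeasure x y p) P) (hXY : IndepFun X Y P) {f : α × β → ℝ}
    (hf : Measurable f) (hx : Integrable (fun ω => f (X ω, x)) P)
    (hy : Integrable (fun ω => f (X ω, y)) P) :
    Integrable (fun ω => f (X ω, Y ω)) P ∧
      ∫ ω, f (X ω, Y ω) ∂P = p * ∫ ω, f (X ω, x) ∂P + (1 - p) * ∫ ω, f (X ω, y) ∂P := by
  have hmap (z : β) : ((P.map X).prod (Measure.dirac z)) = P.map (fun ω => (X ω, z)) := by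
    have := Measure.isProbabilityMeasure_map hX
    rw [Measure.prod_dirac, AEMeasurable.map_map_of_aemeasurable
      (by fun_prop) hX]
    rfl
  have hm (z : β) : AEMeasurable (fun ω => (X ω, z)) P := by fun_prop
  have hxy := hX.prodMk hY.aemeasurable
  have hlaw := hXY.map_prod_eq_prod_map_map hX hY.aemeasurable
  have := Measure.isProbabilityMeasure_map hX
  rw [hY.map_eq, bernoulliMeasure_def, Measure.prod_add, Measure.prod_smul_right,
    Measure.prod_smul_right, hmap, hmap] at hlaw
  have hix : Integrable f (P.map (fun ω => (X ω, x))) :=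
    (integrable_map_measure hf.aestronglyMeasurable (hm x)).2 hx
  have hiy : Integrable f (P.map (fun ω => (X ω, y))) :=
    (integrable_map_measure hf.aestronglyMeasurable (hm y)).2 hy
  refine ⟨(integrable_map_measure hf.aestronglyMeasurable hxy).1 ?_, ?_⟩
  · rw [hlaw]
    exact hix.smul_measure_nnreal.add_measure hiy.smul_measure_nnreal
  · rw [← integral_map hxy hf.aestronglyMeasurable, hlaw,
      integral_add_measure hix.smul_measure_nnreal hiy.smul_measure_nnreal,
      integral_smul_nnreal_measure, integral_smul_nnreal_measure,
      integral_map (hm x) hf.aestronglyMeasurable, integral_map (hm y) hf.aestronglyMeasurable]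
    rfl

/-- Extend a finite tuple of values to a sequence. -/
def extendTuple {α : Type*} [Inhabited α] (S : Finset ℕ) (x : S → α) (i : ℕ) : α :=
  if h : i ∈ S then x ⟨i, h⟩ else default

theorem measurable_extendTuple {α : Type*} [Inhabited α] [MeasurableSpace α] (S : Finset ℕ) :
    Measurable (extendTuple S : (S → α) → ℕ → α) := by
  refine measurable_pi_lambda _ fun i => ?_
  unfold extendTuple
  split_ifs <;> fun_prop

variable {A : ℕ → Ω → ℕ} {coin : ℕ → Ω → Bool}

theorem indepFun_workload_coin (hA : ∀ t, AEMeasurable (A t) P)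
    (hcoin : ∀ t, AEMeasurable (coin t) P) (hcoin_indep : iIndepFun coin P)
    (hA_coin : IndepFun (fun ω t => A t ω) (fun ω t => coin t ω) P) (t : ℕ) :
    IndepFun (fun ω => workload (fun i => A i ω) (fun i => coin i ω) t) (coin t) P := by
  have h1 : IndepFun (coin t) (fun ω (i : Finset.range t) => coin i ω) P :=
    (hcoin_indep.indepFun_finset₀ {t} (Finset.range t) (by simp) hcoin).comp
      (φ := fun x : ({t} : Finset ℕ) → Bool => x ⟨t, by simp⟩) (by fun_prop) measurable_id
  have h2 : IndepFun (fun ω => (coin t ω, fun i : Finset.range t => coin i ω))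
      (fun ω i => A i ω) P :=
    hA_coin.symm.comp (φ := fun c : ℕ → Bool => (c t, fun i : Finset.range t => c i))
      (by fun_prop) measurable_id
  have h3 := indepFun_prodMk_right_of_prodMk_left (hcoin t)
    (aemeasurable_pi_lambda _ fun i : Finset.range t => hcoin i)
    (aemeasurable_pi_lambda _ fun i => hA i) h1 h2
  have hm : Measurable (fun x : (Finset.range t → Bool) × (ℕ → ℕ) =>
      workload x.2 (extendTuple (Finset.range t) x.1) t) :=
    (measurable_workload t).comp
      (measurable_snd.prodMk ((measurable_extendTuple _).comp measurable_fst))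
  have h4 := (h3.comp measurable_id hm).symm
  refine h4.congr (.of_forall fun ω => ?_) .rfl
  -- The workload at `t` uses only coins before `t`, so the default values of `extendTuple` are
  -- never read.
  exact workload_congr (fun i hi => rfl) (fun i hi => by simp [extendTuple, hi])

theorem indepFun_workload_coin_arrival (hA : ∀ t, AEMeasurable (A t) P)
    (hcoin : ∀ t, AEMeasurable (coin t) P) (hA_indep : iIndepFun A P)
    (hA_coin : IndepFun (fun ω t => A t ω) (fun ω t => coin t ω) P) (t : ℕ) :
    IndepFun (fun ω => (workload (fun i => A i ω) (fun i => coin i ω) t, coin t ω))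
      (A (t + 1)) P := by
  have h1 : IndepFun (A (t + 1)) (fun ω (i : Finset.range (t + 1)) => A i ω) P :=
    (hA_indep.indepFun_finset₀ {t + 1} (Finset.range (t + 1)) (by simp) hA).comp
      (φ := fun x : ({t + 1} : Finset ℕ) → ℕ => x ⟨t + 1, by simp⟩)
      (by fun_prop) measurable_id
  have h2 : IndepFun (fun ω => (A (t + 1) ω, fun i : Finset.range (t + 1) => A i ω))
      (fun ω i => coin i ω) P :=
    hA_coin.comp (φ := fun a : ℕ → ℕ => (a (t + 1), fun i : Finset.range (t + 1) => a i))
      (by fun_prop) measurable_id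
  have h3 := indepFun_prodMk_right_of_prodMk_left (hA (t + 1))
    (aemeasurable_pi_lambda _ fun i : Finset.range (t + 1) => hA i)
    (aemeasurable_pi_lambda _ fun i => hcoin i) h1 h2
  have hm : Measurable (fun x : (Finset.range (t + 1) → ℕ) × (ℕ → Bool) =>
      (workload (extendTuple (Finset.range (t + 1)) x.1) x.2 t, x.2 t)) :=
    ((measurable_workload t).comp
      (((measurable_extendTuple _).comp measurable_fst).prodMk measurable_snd)).prodMk
      (by fun_prop)
  have h4 := (h3.comp measurable_id hm).symm
  refine h4.congr (.of_forall fun ω => Prod.ext ?_ rfl) .rfl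
  exact workload_congr (fun i hi => by simp [extendTuple, hi]) (fun i hi => rfl)

/-- The exponent is `t + 1` because slot `0` already counts as one step from state `0`, where
service has no effect. Since `g` is arbitrary, the induction can absorb one step into it. -/
theorem integral_workload (lam p : I)
    (hA : ∀ t, HasLaw (A t) (bernoulliMeasure 1 0 lam) P) (hA_indep : iIndepFun A P)
    (hcoin : ∀ t, HasLaw (coin t) (bernoulliMeasure true false p) P)
    (hcoin_indep : iIndepFun coin P)
    (hA_coin : IndepFun (fun ω t => A t ω) (fun ω t => coin t ω) P) (t : ℕ) (g : ℕ → ℝ) :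
    Integrable (fun ω => g (workload (fun i => A i ω) (fun i => coin i ω) t)) P ∧
      ∫ ω, g (workload (fun i => A i ω) (fun i => coin i ω) t) ∂P =
        (transition lam p)^[t + 1] g 0 := by
  have hAm t := (hA t).aemeasurable
  have hcm t := (hcoin t).aemeasurable
  have hW (t : ℕ) :
      AEMeasurable (fun ω => workload (fun i => A i ω) (fun i => coin i ω) t) P :=
    (measurable_workload t).comp_aemeasurable
      ((aemeasurable_pi_lambda _ hAm).prodMk (aemeasurable_pi_lambda _ hcm))
  induction t generalizing g with
  | zero =>
    -- There is no past yet, so a constant stands in for it.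
    have h := integral_bernoulli_of_indepFun (P := P) (X := fun _ => ()) (f := fun z => g (2 * z.2))
      (by fun_prop) (hA 0) (indepFun_const_left _ _) (measurable_of_countable _)
      (integrable_const _) (integrable_const _)
    refine ⟨h.1, h.2.trans ?_⟩
    simp [transition, serve]
    ring
  | succ t ih =>
    have hstep (G : ℕ × Bool → ℝ) := integral_bernoulli_of_indepFun (hW t) (hcoin t)
      (indepFun_workload_coin hAm hcm hcoin_indep hA_coin t) (f := G) (measurable_of_countable _)
      (ih fun w => G (w, true)).1 (ih fun w => G (w, false)).1
    have h := integral_bernoulli_of_indepFun ((hW t).prodMk (hcm t)) (hA (t + 1))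
      (indepFun_workload_coin_arrival hAm hcm hA_indep hA_coin t)
      (f := fun z => g (serve z.1.1 z.1.2 + 2 * z.2)) (measurable_of_countable _)
      (hstep fun z => g (serve z.1 z.2 + 2 * 1)).1 (hstep fun z => g (serve z.1 z.2 + 2 * 0)).1
    refine ⟨h.1, h.2.trans ?_⟩
    rw [Function.iterate_succ_apply, ← (ih (transition lam p g)).2,
      (hstep fun z => g (serve z.1 z.2 + 2 * 1)).2, (hstep fun z => g (serve z.1 z.2 + 2 * 0)).2]
    have i1 := (ih fun w => g (serve w true + 2)).1
    have i2 := (ih fun w => g (serve w false + 2)).1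
    have i3 := (ih fun w => g (serve w true)).1
    have i4 := (ih fun w => g (serve w false)).1
    have hmix {f₁ f₂ : Ω → ℝ} (a : ℝ) (h₁ : Integrable f₁ P) (h₂ : Integrable f₂ P) :
        ∫ ω, (a * f₁ ω + (1 - a) * f₂ ω) ∂P = a * ∫ ω, f₁ ω ∂P + (1 - a) * ∫ ω, f₂ ω ∂P := by
      rw [integral_add (h₁.const_mul _) (h₂.const_mul _), integral_const_mul, integral_const_mul]
    have i12 := (i1.const_mul (p : ℝ)).add (i2.const_mul (1 - p : ℝ))
    have i34 := (i3.const_mul (p : ℝ)).add (i4.const_mul (1 - p : ℝ))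
    exact ((hmix _ i12 i34).trans (congrArg₂ _ (congrArg _ (hmix _ i1 i2))
      (congrArg _ (hmix _ i3 i4)))).symm

end Probability

end SpectrumSharing

theorem corollary1 {Ω : Type*} [MeasurableSpace Ω] (P : Measure Ω) [IsProbabilityMeasure P]
    (lam : I) (hlam0 : 0 < lam) (hlam1 : lam < 1)
    -- i.i.d. Bernoulli(`lam`) arrivals to the uncooperative user
    (A : ℕ → Ω → ℕ) (hA : ∀ t, HasLaw (A t) (bernoulliMeasure 1 0 lam) P)
    (hA_indep : iIndepFun A P)
    -- i.i.d. coin flips of the policy, with probability of heads `p*`, independent of the arrivals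
    (coin : ℕ → Ω → Bool)
    (hcoin : ∀ t, HasLaw (coin t) (bernoulliMeasure true false (SpectrumSharing.pStar lam)) P)
    (hcoin_indep : iIndepFun coin P)
    (hA_coin : IndepFun (fun ω t => A t ω) (fun ω t => coin t ω) P) :
    (∀ T, Integrable
      (fun ω => (SpectrumSharing.backlog (fun t => A t ω) (fun t => coin t ω) T : ℝ)) P) ∧
    ∃ L : ℝ, Tendsto
      (fun T => ∫ ω, (SpectrumSharing.backlog (fun t => A t ω) (fun t => coin t ω) T : ℝ) ∂P)
      atTop (𝓝 L) := by
  have h := SpectrumSharing.integral_workload lam (SpectrumSharing.pStar lam) hA hA_indep hcoin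
    hcoin_indep hA_coin
  simp only [SpectrumSharing.backlog_eq_workload]
  refine ⟨fun T => (h T fun w => (((w + 1) / 2 : ℕ) : ℝ)).1, ?_⟩
  obtain ⟨L, hL⟩ := SpectrumSharing.transition_iterate_queue_tendsto lam.2
    (SpectrumSharing.pStar lam).2 (SpectrumSharing.lt_one_div_one_add_pStar lam hlam0 hlam1)
  refine ⟨L, (hL.comp (tendsto_add_atTop_nat 1)).congr fun T => ?_⟩
  exact (h T fun w => (((w + 1) / 2 : ℕ) : ℝ)).2.symm
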